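/- Let $\Gamma=(V,E)$ and $\Gamma'=(V',E')$ be finite simple graphs, let $G$ be a group, and let $(G_v)_{v\in V}$ and $(G_{v'})_{v'\in V'}$ be families of nontrivial finite subgroups of $G$, indexed by disjoint vertex sets. Suppose that $G$ is the internal graph product of both $(\Gamma,G_v)$ and $(\Gamma',G_{v'})$. Here the graph product of $(\Gamma,G_v)$ is the quotient of the free product of the groups $G_v$, $v\in V$, by the normal closure of all commutators $g^{-1}h^{-1}gh$ with $g\in G_u$, $h\in G_v$, $\{u,v\}\in E$; and $G$ is the internal graph product of subgroups $G_v$ if there is an isomorphism from their graph product onto $G$ that restricts to the inclusion $G_v\hookrightarrow G$ on each vertex group. Suppose further that $\Gamma$ and $\Gamma'$ are $T_0$, that is, no edge is a module: for every edge $\{u,v\}$ there is a vertex $w\notin\{u,v\}$ that is adjacent to exactly one of $u$ and $v$. Then $(\Gamma,G_v)$ and $(\Gamma',G_{v'})$ are isomorphic graphs of groups: there is a graph isomorphism $\phi\colon\Gamma\to\Gamma'$ such that $G_v\cong G_{\phi(v)}$ for every $v\in V$. -/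

import Mathlib

/-- A set `X` of vertices is a module of `Γ` if every vertex outside `X` is adjacent to every element
of `X` or to no element of `X`. -/
def SimpleGraph.IsModule {V : Type*} (Γ : SimpleGraph V) (X : Set V) : Prop :=
  ∀ w, w ∉ X → (∀ x ∈ X, Γ.Adj w x) ∨ (∀ x ∈ X, ¬ Γ.Adj w x)

/-- A graph is `T₀` if no edge is a module. -/
def SimpleGraph.IsT0 {V : Type*} (Γ : SimpleGraph V) : Prop :=
  ∀ u v, Γ.Adj u v → ¬ Γ.IsModule {u, v}

/-- The commutators `g⁻¹ h⁻¹ g h` in the free product of the groups `A v`, where `g` and `h` are taken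
from the groups of two adjacent vertices. -/
def graphProductRelators {V : Type*} (Γ : SimpleGraph V) (A : V → Type*) [∀ v, Group (A v)] :
    Set (Monoid.CoprodI A) :=
  {r | ∃ (u v : V) (g : A u) (h : A v), Γ.Adj u v ∧
    r = (Monoid.CoprodI.of g)⁻¹ * (Monoid.CoprodI.of h)⁻¹ *
      Monoid.CoprodI.of g * Monoid.CoprodI.of h}

/-- The graph product of the groups `A v` over the graph `Γ`: the quotient of their free product by the
normal closure of the commutators of elements of adjacent groups. -/
def GraphProduct {V : Type*} (Γ : SimpleGraph V) (A : V → Type*) [∀ v, Group (A v)] : Type _ :=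
  Monoid.CoprodI A ⧸ Subgroup.normalClosure (graphProductRelators Γ A)

instance {V : Type*} (Γ : SimpleGraph V) (A : V → Type*) [∀ v, Group (A v)] :
    Group (GraphProduct Γ A) :=
  inferInstanceAs (Group (Monoid.CoprodI A ⧸ Subgroup.normalClosure (graphProductRelators Γ A)))

/-- The canonical homomorphism from a vertex group to the graph product. -/
def GraphProduct.of {V : Type*} (Γ : SimpleGraph V) (A : V → Type*) [∀ v, Group (A v)] (v : V) :
    A v →* GraphProduct Γ A :=
  (QuotientGroup.mk' (Subgroup.normalClosure (graphProductRelators Γ A))).comp Monoid.CoprodI.of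

/-- `G` is the internal graph product of its subgroups `H v` over `Γ`: there is an isomorphism from the
graph product of the `H v` onto `G` under which the canonical image of each vertex group `H v` is
identified with the subgroup `H v` itself. -/
def IsInternalGraphProduct {G : Type*} [Group G] {V : Type*} (Γ : SimpleGraph V)
    (H : V → Subgroup G) : Prop :=
  ∃ e : GraphProduct Γ (fun v => H v) ≃* G,
    ∀ (v : V) (x : H v), e (GraphProduct.of Γ (fun v => H v) v x) = (x : G)

/-- Two graphs of groups `(Γ, A)` and `(Γ', A')` (one group for each vertex) are isomorphic if there is
a graph isomorphism `φ` such that `A v` and `A' (φ v)` are isomorphic for all vertices `v`. -/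
def IsomorphicGraphsOfGroups {V V' : Type*} (Γ : SimpleGraph V) (A : V → Type*) [∀ v, Group (A v)]
    (Γ' : SimpleGraph V') (A' : V' → Type*) [∀ v, Group (A' v)] : Prop :=
  ∃ φ : Γ ≃g Γ', ∀ v, Nonempty (A v ≃* A' (φ v))

/-! Finite subgroups detect cliques: every finite subgroup of a graph product is conjugate into the
direct product spanned by a clique. To see this, split off a vertex v of S that is not adjacent to
all the others. The product over S is then a free product of conjugates of G_v, indexed by cosets of
the link subgroup, extended by the product over S \ {v}. A finite subgroup acts on that free product
by affine isometries of the tree-like syllable metric, so it fixes a point or preserves a coset of a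
factor. Accordingly it is conjugate into the product over S \ {v} or over the star of v
(`exists_conj_of_finite_splitting`), and S shrinks.

Hence the maximal cliques of the two graphs correspond. The map onto the direct product of all
vertex groups shows that corresponding intersections of maximal cliques carry isomorphic groups,
although the conjugators vary with the clique. In a T₀ graph a vertex is determined by the maximal
cliques containing it. Counting homomorphisms from a finite group turns the intersection groups into
products of numbers, Möbius inversion isolates the factor of a single vertex, and Lovász's theorem
recovers its group. Adjacency means lying in a common maximal clique. -/

namespace Monoid.CoprodI

/-! ### Free products and their syllable metric -/

variable {ι : Type*} {G : ι → Type*} [∀ i, Group (G i)]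

open scoped Classical in
/-- The syllable length of an element of a free product: the length of its reduced word. -/
noncomputable def syllableLength (x : CoprodI G) : ℕ := (Word.equiv x).toList.length

theorem syllableLength_prod (w : Word G) : syllableLength w.prod = w.toList.length := by
  classical
  have : Word.equiv w.prod = w := Word.equiv.apply_symm_apply w
  rw [syllableLength]
  convert congrArg (fun w : Word G => w.toList.length) this

theorem exists_word (x : CoprodI G) : ∃ w : Word G, w.prod = x := by
  classical
  exact ⟨Word.equiv x, Word.equiv.symm_apply_apply x⟩

/-- If no cancellation or amalgamation occurs between two reduced words `v⁻¹` and `w`, then lengths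
add up. -/
theorem syllableLength_inv_prod_mul (v : Word G) :
    ∀ w : Word G, (∀ i, v.fstIdx = some i → w.fstIdx ≠ some i) →
      syllableLength (v.prod⁻¹ * w.prod) = v.toList.length + w.toList.length := by
  induction v using Word.consRecOn with
  | empty => intro w _; simp [syllableLength_prod]
  | cons i m v h1 h2 ih =>
    intro w hw
    have hw' : w.fstIdx ≠ some i := hw i (by simp)
    have h3 : m⁻¹ ≠ 1 := inv_ne_one.mpr h2
    -- The first letter of the left word moves, inverted, to the front of `w`; the total length is
    -- unchanged.
    have key := ih (Word.cons m⁻¹ w hw' h3) (by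
      intro j hj hj'
      rw [Word.fstIdx_cons] at hj'
      exact h1 (hj.trans hj'.symm))
    rw [Word.prod_cons, ← mul_assoc] at key
    rw [Word.prod_cons, mul_inv_rev, ← map_inv, key]
    simp only [Word.cons_toList, List.length_cons]
    omega

/-- A vertex separating two points strictly decreases one of the distances to any third point. -/
theorem lt_syllableLength_of_fstIdx_ne {u v : Word G} {i j : ι} (hu : u.fstIdx = some i)
    (hv : v.fstIdx = some j) (hij : i ≠ j) (w : Word G) :
    syllableLength w.prod < syllableLength (u.prod⁻¹ * w.prod) ∨
      syllableLength w.prod < syllableLength (v.prod⁻¹ * w.prod) := by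
  have pos : ∀ {u : Word G} {i : ι}, u.fstIdx = some i → 0 < u.toList.length := by
    intro u i hu
    rcases u with ⟨_ | _, _, _⟩
    · simp [Word.fstIdx] at hu
    · simp
  rw [syllableLength_prod]
  by_cases hw : w.fstIdx = some i
  · right
    rw [syllableLength_inv_prod_mul v w]
    · have := pos hv; omega
    · intro k hk hk'
      rw [hv] at hk; rw [hw] at hk'
      exact hij (Option.some.inj (hk'.trans hk.symm))
  · left
    rw [syllableLength_inv_prod_mul u w]
    · have := pos hu; omega
    · intro k hk hk'
      rw [hu] at hk
      exact hw (hk'.trans hk.symm)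

theorem exists_of_of_syllableLength_le_one {x : CoprodI G} (h : syllableLength x ≤ 1)
    (hx : x ≠ 1) : ∃ i, ∃ g : G i, g ≠ 1 ∧ x = of g := by
  obtain ⟨w, rfl⟩ := exists_word x
  rw [syllableLength_prod] at h
  induction w using Word.consRecOn with
  | empty => simp at hx
  | cons i m w h1 h2 _ =>
    refine ⟨i, m, h2, ?_⟩
    have : w = Word.empty := by
      apply Word.ext
      simpa using h
    subst this
    simp

/-- The first vertex after `x` on the way to `y` is a cut point: seen from it, `x` and `y` lie in
the directions of different factors. -/
theorem exists_separating {x y : CoprodI G} (h : 1 < syllableLength (x⁻¹ * y)) :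
    ∃ z : CoprodI G, ∀ o : CoprodI G,
      syllableLength (z⁻¹ * o) < syllableLength (x⁻¹ * o) ∨
        syllableLength (z⁻¹ * o) < syllableLength (y⁻¹ * o) := by
  obtain ⟨w, hw⟩ := exists_word (x⁻¹ * y)
  rw [← hw, syllableLength_prod] at h
  induction w using Word.consRecOn with
  | empty => simp at h
  | cons i m w h1 h2 _ =>
    rw [Word.prod_cons] at hw
    induction w using Word.consRecOn with
    | empty => simp at h
    | cons j n v h3 h4 _ =>
      rw [Word.fstIdx_cons] at h1
      have hji : j ≠ i := fun e => h1 (by rw [e])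
      refine ⟨x * of m, fun o => ?_⟩
      obtain ⟨u, hu⟩ := exists_word ((x * of m)⁻¹ * o)
      have hm : m⁻¹ ≠ 1 := inv_ne_one.mpr h2
      have key := lt_syllableLength_of_fstIdx_ne
        (u := Word.cons m⁻¹ Word.empty (by simp [Word.fstIdx]) hm)
        (v := Word.cons n v h3 h4) (by simp) (by simp) hji.symm u
      rw [hu] at key
      have hx : x⁻¹ * o =
          (Word.cons m⁻¹ Word.empty (by simp [Word.fstIdx]) hm).prod⁻¹ * ((x * of m)⁻¹ * o) := by
        rw [Word.prod_cons, Word.prod_empty, map_inv]; group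
      have hy : y⁻¹ * o = (Word.cons n v h3 h4).prod⁻¹ * ((x * of m)⁻¹ * o) := by
        have : (Word.cons n v h3 h4).prod = (of m)⁻¹ * (x⁻¹ * y) := by rw [← hw]; group
        rw [this]; group
      rw [hx, hy]
      exact key

/-- A finite group of isometries of a free product with its syllable metric fixes a point, or
stabilizes a left coset of a free factor. -/
theorem exists_fixed_or_coset {F : Type*} [Group F] [Finite F]
    (σ : F →* Equiv.Perm (CoprodI G))
    (hσ : ∀ f x y, syllableLength ((σ f x)⁻¹ * σ f y) = syllableLength (x⁻¹ * y)) :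
    (∃ x, ∀ f, σ f x = x) ∨
      ∃ x, ∃ i, ∃ g : G i, g ≠ 1 ∧ ∀ f, (∃ a : G i, x⁻¹ * σ f x = of a) ∧
        ∃ a : G i, x⁻¹ * σ f (x * of g) = of a := by
  have := Fintype.ofFinite F
  -- Distance from `x` to the farthest point of the orbit of 1. Its minimizers play the role of the
  -- center of the orbit.
  let ecc : CoprodI G → ℕ := fun x => Finset.univ.sup fun f => syllableLength (x⁻¹ * σ f 1)
  have hecc : ∀ x f, syllableLength (x⁻¹ * σ f 1) ≤ ecc x := fun x f =>
    Finset.le_sup (f := fun f => syllableLength (x⁻¹ * σ f 1)) (Finset.mem_univ f)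
  have hinv : ∀ f x, ecc (σ f x) ≤ ecc x := by
    intro f x
    refine Finset.sup_le fun k _ => ?_
    have : σ k 1 = σ f (σ (f⁻¹ * k) 1) := by
      rw [← Equiv.Perm.mul_apply, ← map_mul, mul_inv_cancel_left]
    rw [this, hσ]
    exact hecc x _
  obtain ⟨x, hx⟩ : ∃ x, ∀ y, ecc x ≤ ecc y :=
    ⟨Function.argmin ecc, fun y => Function.argmin_le ecc y⟩
  have hclose : ∀ y z, ecc y = ecc x → ecc z = ecc x → syllableLength (y⁻¹ * z) ≤ 1 := by
    intro y z hy hz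
    by_contra! h
    obtain ⟨t, ht⟩ := exists_separating h
    -- The orbit point farthest from `t` is strictly farther from `y` or from `z`.
    have : ecc t < ecc x := by
      by_contra! hlt
      obtain ⟨f, -, hf⟩ := Finset.exists_mem_eq_sup Finset.univ Finset.univ_nonempty
        fun f => syllableLength (t⁻¹ * σ f 1)
      have hf' : ecc t = syllableLength (t⁻¹ * σ f 1) := hf
      rcases ht (σ f 1) with h1 | h1
      · have := hecc y f; omega
      · have := hecc z f; omega
    exact absurd (hx t) (by omega)
  have hfix : ∀ f y, ecc y = ecc x → ecc (σ f y) = ecc x := fun f y hy =>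
    le_antisymm ((hinv f y).trans hy.le) (hx _)
  by_cases hfx : ∀ f, σ f x = x
  · exact Or.inl ⟨x, hfx⟩
  right
  push Not at hfx
  obtain ⟨f₀, hf₀⟩ := hfx
  obtain ⟨i, g, hg, hxg⟩ := exists_of_of_syllableLength_le_one
    (hclose x (σ f₀ x) rfl (hfix f₀ x rfl)) (fun h => hf₀ (inv_mul_eq_one.mp h).symm)
  have hxg' : x * of g = σ f₀ x := by rw [← hxg]; group
  -- A minimizer differing from `x` by a letter of another factor would be at distance 2 from the
  -- minimizer `x * of g`.
  have main : ∀ y, ecc y = ecc x → ∃ a : G i, x⁻¹ * y = of a := by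
    intro y hy
    by_cases hy1 : x⁻¹ * y = 1
    · exact ⟨1, by rw [hy1, map_one]⟩
    obtain ⟨j, b, hb, hyb⟩ := exists_of_of_syllableLength_le_one (hclose x y rfl hy) hy1
    by_cases hij : j = i
    · subst hij; exact ⟨b, hyb⟩
    exfalso
    have h2 := hclose (x * of g) y (by rw [hxg']; exact hfix f₀ x rfl) hy
    have h3 := syllableLength_inv_prod_mul (Word.cons g Word.empty (by simp [Word.fstIdx]) hg)
      (Word.cons b Word.empty (by simp [Word.fstIdx]) hb) (by
        intro k hk hk'
        rw [Word.fstIdx_cons] at hk hk'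
        exact hij (Option.some.inj (hk'.trans hk.symm)))
    simp only [Word.prod_cons, Word.prod_empty, mul_one] at h3
    rw [mul_inv_rev, mul_assoc, hyb, h3] at h2
    simp at h2
  refine ⟨x, i, g, hg, fun f => ⟨main _ (hfix f x rfl), main _ (hfix f _ ?_)⟩⟩
  rw [hxg']; exact hfix f₀ x rfl

end Monoid.CoprodI

namespace Monoid.CoprodI

/-! ### Affine actions on free products of copies of one group -/

variable {Q I A : Type*} [Group Q] [MulAction Q I] [Group A]

/-- The endomorphism of a free product of copies of one group that permutes the copies. -/
def permEnd (A : Type*) [Group A] (q : Q) :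
    CoprodI (fun _ : I => A) →* CoprodI (fun _ : I => A) :=
  lift fun i => of (M := fun _ : I => A) (i := q • i)

theorem permEnd_of (q : Q) (i : I) (a : A) :
    permEnd A q (of (M := fun _ : I => A) (i := i) a) = of (M := fun _ : I => A) (i := q • i) a :=
  lift_of _ _

theorem permEnd_comp (q r : Q) :
    (permEnd A q).comp (permEnd A r) = permEnd (I := I) A (q * r) := by
  refine ext_hom _ _ fun i => ?_
  ext a
  simp only [MonoidHom.comp_apply, permEnd_of, mul_smul]

theorem permEnd_one : permEnd (I := I) A (1 : Q) = MonoidHom.id _ := by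
  refine ext_hom _ _ fun i => ?_
  ext a
  simp only [MonoidHom.comp_apply, permEnd_of, one_smul, MonoidHom.id_apply]

/-- A group acting on the index set acts by automorphisms on the free product of copies of one
group. -/
def permAut (Q I A : Type*) [Group Q] [MulAction Q I] [Group A] :
    Q →* MulAut (CoprodI (fun _ : I => A)) where
  toFun q := MonoidHom.toMulEquiv (permEnd A q) (permEnd A q⁻¹)
    (by rw [permEnd_comp, inv_mul_cancel, permEnd_one])
    (by rw [permEnd_comp, mul_inv_cancel, permEnd_one])
  map_one' := by
    ext x
    exact DFunLike.congr_fun permEnd_one x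
  map_mul' q r := by
    ext x
    exact (DFunLike.congr_fun (permEnd_comp q r) x).symm

theorem permAut_of (q : Q) (i : I) (a : A) :
    permAut Q I A q (of (M := fun _ : I => A) (i := i) a) =
      of (M := fun _ : I => A) (i := q • i) a :=
  permEnd_of q i a

theorem syllableLength_permAut (q : Q) (x : CoprodI (fun _ : I => A)) :
    syllableLength (permAut Q I A q x) = syllableLength x := by
  obtain ⟨w, rfl⟩ := exists_word x
  suffices ∃ w' : Word (fun _ : I => A), w'.prod = permAut Q I A q w.prod ∧
      w'.toList.length = w.toList.length ∧ w'.fstIdx = w.fstIdx.map (q • ·) by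
    obtain ⟨w', h1, h2, -⟩ := this
    rw [← h1, syllableLength_prod, syllableLength_prod, h2]
  induction w using Word.consRecOn with
  | empty => exact ⟨Word.empty, by simp, rfl, rfl⟩
  | cons i m w h1 h2 ih =>
    obtain ⟨w', h3, h4, h5⟩ := ih
    refine ⟨Word.cons (i := q • i) m w' ?_ h2, ?_, ?_, ?_⟩
    · rw [h5]
      intro h
      apply h1
      cases hw : w.fstIdx with
      | none => rw [hw] at h; simp at h
      | some j => rw [hw] at h; simpa using h
    · rw [Word.prod_cons, Word.prod_cons, map_mul, permAut_of, h3]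
    · simp [h4]
    · simp

/-- A finite group of affine transformations of a free product of copies of one group fixes a
point or stabilizes a coset of one of the copies. -/
theorem exists_conj_of_finite (F : Subgroup (CoprodI (fun _ : I => A) ⋊[permAut Q I A] Q))
    [Finite F] :
    (∃ x, ∀ f ∈ F, (SemidirectProduct.inl x)⁻¹ * f * SemidirectProduct.inl x =
        SemidirectProduct.inr f.right) ∨
      ∃ x, ∃ i : I, ∀ f ∈ F, f.right • i = i ∧
        ∃ a : A, (SemidirectProduct.inl x)⁻¹ * f * SemidirectProduct.inl x =
          SemidirectProduct.inl (of (M := fun _ : I => A) (i := i) a) *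
            SemidirectProduct.inr f.right := by
  classical
  let act : F →* Equiv.Perm (CoprodI (fun _ : I => A)) :=
    MonoidHom.toHomPerm
      { toFun := fun f x => f.1.left * permAut Q I A f.1.right x
        map_one' := by funext x; simp; rfl
        map_mul' := by
          intro f g
          funext x
          change _ = f.1.left * permAut Q I A f.1.right (g.1.left * permAut Q I A g.1.right x)
          simp [mul_assoc] }
  have hact : ∀ f x, act f x = f.1.left * permAut Q I A f.1.right x := fun _ _ => rfl
  have hleft : ∀ (f : F) x, (SemidirectProduct.inl x)⁻¹ * f.1 * SemidirectProduct.inl x =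
      SemidirectProduct.inl (x⁻¹ * act f x) * SemidirectProduct.inr f.1.right := by
    intro f x
    rw [hact]
    ext <;> simp [mul_assoc]
  have hiso : ∀ f x y, syllableLength ((act f x)⁻¹ * act f y) = syllableLength (x⁻¹ * y) := by
    intro f x y
    rw [hact, hact, ← syllableLength_permAut f.1.right (x⁻¹ * y), map_mul, map_inv]
    congr 1
    group
  rcases exists_fixed_or_coset act hiso with ⟨x, hx⟩ | ⟨x, i, g, hg, h⟩
  · refine Or.inl ⟨x, fun f hf => ?_⟩
    have := hleft ⟨f, hf⟩ x
    rw [hx] at this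
    simpa using this
  · refine Or.inr ⟨x, i, fun f hf => ?_⟩
    obtain ⟨⟨a, ha⟩, b, hb⟩ := h ⟨f, hf⟩
    have h1 := hleft ⟨f, hf⟩ x
    rw [ha] at h1
    refine ⟨?_, a, h1⟩
    -- The images of `x` and `x * of g` differ by a letter of index `f.right • i`, yet both lie in
    -- the coset of index `i`. Projecting to one factor forces the indices to agree.
    have h2 : of (M := fun _ : I => A) (i := f.right • i) g =
        of (M := fun _ : I => A) (i := i) (a⁻¹ * b) := by
      rw [map_mul, ← hb, map_inv, ← ha, hact, hact, map_mul, permAut_of]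
      group
    by_contra hne
    have h3 := congrArg (lift (Pi.mulSingle (f.right • i) (MonoidHom.id A))) h2
    rw [lift_of, lift_of, Pi.mulSingle_eq_same, Pi.mulSingle_eq_of_ne (Ne.symm hne)] at h3
    exact hg h3

end Monoid.CoprodI

namespace GraphProduct

/-! ### Graph products and conjugation of finite subgroups into cliques -/

variable {V : Type*} {Γ : SimpleGraph V} {A : V → Type*} [∀ v, Group (A v)]

theorem commute_of_of {u v : V} (h : Γ.Adj u v) (x : A u) (y : A v) :
    Commute (of Γ A u x) (of Γ A v y) := by
  have hmem : (Monoid.CoprodI.of x)⁻¹ * (Monoid.CoprodI.of y)⁻¹ *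
      Monoid.CoprodI.of x * Monoid.CoprodI.of y ∈
        Subgroup.normalClosure (graphProductRelators Γ A) :=
    Subgroup.subset_normalClosure ⟨u, v, x, y, h, rfl⟩
  have h1 := (QuotientGroup.eq_one_iff (N := Subgroup.normalClosure (graphProductRelators Γ A))
    _).mpr hmem
  have h2 : (of Γ A u x)⁻¹ * (of Γ A v y)⁻¹ * of Γ A u x * of Γ A v y = 1 := h1
  rw [mul_assoc, ← mul_inv_rev, inv_mul_eq_one] at h2
  exact h2.symm

/-- The universal property of the graph product. -/
def lift {N : Type*} [Group N] (f : ∀ v, A v →* N)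
    (hf : ∀ u v, Γ.Adj u v → ∀ x y, Commute (f u x) (f v y)) : GraphProduct Γ A →* N :=
  QuotientGroup.lift (Subgroup.normalClosure (graphProductRelators Γ A)) (Monoid.CoprodI.lift f) <|
    Subgroup.normalClosure_le_normal (N := (Monoid.CoprodI.lift f).ker) <| by
      rintro _ ⟨u, v, x, y, h, rfl⟩
      simp only [SetLike.mem_coe, MonoidHom.mem_ker, map_mul, map_inv, Monoid.CoprodI.lift_of]
      rw [mul_assoc, ← mul_inv_rev, inv_mul_eq_one]
      exact (hf u v h x y).symm

@[simp]
theorem lift_of {N : Type*} [Group N] (f : ∀ v, A v →* N)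
    (hf : ∀ u v, Γ.Adj u v → ∀ x y, Commute (f u x) (f v y)) (v : V) (x : A v) :
    lift f hf (of Γ A v x) = f v x :=
  Monoid.CoprodI.lift_of f x

variable (Γ A) in
/-- The subgroup of a graph product generated by the vertex groups in a set of vertices. -/
def sub (S : Set V) : Subgroup (GraphProduct Γ A) := ⨆ v ∈ S, (of Γ A v).range

theorem of_mem_sub {S : Set V} {v : V} (hv : v ∈ S) (x : A v) : of Γ A v x ∈ sub Γ A S :=
  (le_iSup₂ (f := fun v (_ : v ∈ S) => (of Γ A v).range) v hv) ⟨x, rfl⟩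

theorem sub_le {S : Set V} {T : Subgroup (GraphProduct Γ A)}
    (h : ∀ v ∈ S, ∀ x, of Γ A v x ∈ T) : sub Γ A S ≤ T := by
  refine iSup₂_le fun v hv => ?_
  rintro _ ⟨x, rfl⟩
  exact h v hv x

theorem sub_mono {S T : Set V} (h : S ⊆ T) : sub Γ A S ≤ sub Γ A T :=
  sub_le fun _ hv x => of_mem_sub (h hv) x

theorem sub_univ : sub Γ A Set.univ = ⊤ := by
  rw [eq_top_iff]
  rintro g -
  obtain ⟨x, rfl⟩ := QuotientGroup.mk'_surjective _ g
  induction x using Monoid.CoprodI.induction_on with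
  | one => rw [map_one]; exact one_mem _
  | of v a => exact of_mem_sub (Set.mem_univ v) a
  | mul x y hx hy => rw [map_mul]; exact mul_mem hx hy

section Splitting

variable (Γ A) (S : Set V) (v : V)

/-- The subgroup generated by the vertices of `S` in the link of `v`. -/
abbrev linkSub : Subgroup (GraphProduct Γ A) := sub Γ A {w ∈ S | Γ.Adj v w}

theorem commute_of_mem_linkSub {c : GraphProduct Γ A} (hc : c ∈ linkSub Γ A S v) (x : A v) :
    Commute c (of Γ A v x) := by
  have : linkSub Γ A S v ≤ Subgroup.centralizer {of Γ A v x} := by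
    refine sub_le fun w hw y => ?_
    rw [Subgroup.mem_centralizer_singleton_iff]
    exact (commute_of_of hw.2 x y).symm
  exact Subgroup.mem_centralizer_singleton_iff.mp (this hc)

/-- The semidirect product with the free product of copies of the vertex group of `v`, indexed by
the cosets of the subgroup of the link. -/
abbrev Splitting : Type _ :=
  Monoid.CoprodI (fun _ : GraphProduct Γ A ⧸ linkSub Γ A S v => A v) ⋊[Monoid.CoprodI.permAut
    (GraphProduct Γ A) (GraphProduct Γ A ⧸ linkSub Γ A S v) (A v)] GraphProduct Γ A

open scoped Classical in
/-- The homomorphism splitting off the vertex group of `v`. -/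
noncomputable def toSplitting : GraphProduct Γ A →* Splitting Γ A S v :=
  lift
    (fun w =>
      if h : w = v then
        h ▸ (SemidirectProduct.inl.comp (Monoid.CoprodI.of
          (M := fun _ : GraphProduct Γ A ⧸ linkSub Γ A S v => A v) (i := (1 : GraphProduct Γ A))) :
          A v →* Splitting Γ A S v)
      -- The value 1 outside `S` is a default: the map matters only on `sub Γ A S`.
      else if w ∈ S then SemidirectProduct.inr.comp (of Γ A w) else 1) <| by
    have key : ∀ w ∈ S, Γ.Adj v w → ∀ (x : A v) (y : A w),
        Commute (SemidirectProduct.inl (Monoid.CoprodI.of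
          (M := fun _ : GraphProduct Γ A ⧸ linkSub Γ A S v => A v)
            (i := (1 : GraphProduct Γ A)) x) : Splitting Γ A S v)
          (SemidirectProduct.inr (of Γ A w y)) := by
      intro w hw hvw x y
      have h1 := SemidirectProduct.inl_aut (φ := Monoid.CoprodI.permAut
        (GraphProduct Γ A) (GraphProduct Γ A ⧸ linkSub Γ A S v) (A v)) (of Γ A w y)
        (Monoid.CoprodI.of (M := fun _ : GraphProduct Γ A ⧸ linkSub Γ A S v => A v)
            (i := (1 : GraphProduct Γ A)) x)
      have h2 : of Γ A w y • ((1 : GraphProduct Γ A) : GraphProduct Γ A ⧸ linkSub Γ A S v) =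
          ((1 : GraphProduct Γ A) : GraphProduct Γ A ⧸ linkSub Γ A S v) := by
        rw [MulAction.Quotient.smul_coe, smul_eq_mul, mul_one, QuotientGroup.eq, mul_one]
        exact inv_mem (of_mem_sub (show w ∈ {w ∈ S | Γ.Adj v w} from ⟨hw, hvw⟩) y)
      rw [Monoid.CoprodI.permAut_of, h2, map_inv] at h1
      exact (eq_mul_inv_iff_mul_eq.mp h1)
    intro u w huw x y
    by_cases hu : u = v
    · subst hu
      have hw : w ≠ u := huw.ne'
      by_cases hwS : w ∈ S
      · simpa [hw, hwS] using key w hwS huw x y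
      · simp [hw, hwS]
    · by_cases hw : w = v
      · subst hw
        by_cases huS : u ∈ S
        · simpa [hu, huS] using (key u huS huw.symm y x).symm
        · simp [hu, huS]
      · by_cases huS : u ∈ S <;> by_cases hwS : w ∈ S <;> simp [hu, hw, huS, hwS]
        exact (commute_of_of huw x y).map _

theorem toSplitting_of_self (x : A v) :
    toSplitting Γ A S v (of Γ A v x) = SemidirectProduct.inl (Monoid.CoprodI.of
          (M := fun _ : GraphProduct Γ A ⧸ linkSub Γ A S v => A v)
            (i := (1 : GraphProduct Γ A)) x) := by
  rw [toSplitting, lift_of, dif_pos rfl]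
  rfl

theorem toSplitting_of_ne {w : V} (hw : w ∈ S) (hwv : w ≠ v) (x : A w) :
    toSplitting Γ A S v (of Γ A w x) = SemidirectProduct.inr (of Γ A w x) := by
  rw [toSplitting, lift_of, dif_neg hwv, if_pos hw]
  rfl

/-- The map from the free product of copies of the vertex group of `v`: the copies are sent to the
conjugates of the vertex group. -/
noncomputable def kernelHom :
    Monoid.CoprodI (fun _ : GraphProduct Γ A ⧸ linkSub Γ A S v => A v) →* GraphProduct Γ A :=
  Monoid.CoprodI.lift fun i => (MulAut.conj (Quotient.out i)).toMonoidHom.comp (of Γ A v)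

/-- The chosen coset representative is irrelevant because the link subgroup commutes with the vertex
group of `v`. -/
theorem kernelHom_of (b : GraphProduct Γ A) (x : A v) :
    kernelHom Γ A S v (Monoid.CoprodI.of
      (M := fun _ : GraphProduct Γ A ⧸ linkSub Γ A S v => A v) (i := b) x) =
      b * of Γ A v x * b⁻¹ := by
  rw [kernelHom, Monoid.CoprodI.lift_of]
  obtain ⟨c, hc⟩ := QuotientGroup.mk_out_eq_mul (linkSub Γ A S v) b
  change Quotient.out (b : GraphProduct Γ A ⧸ linkSub Γ A S v) * of Γ A v x *
    (Quotient.out (b : GraphProduct Γ A ⧸ linkSub Γ A S v))⁻¹ = _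
  rw [hc, mul_inv_rev, mul_assoc b, (commute_of_mem_linkSub Γ A S v c.2 x).eq]
  group

/-- The inverse of `toSplitting` on the subgroup generated by `S`. -/
noncomputable def ofSplitting : Splitting Γ A S v →* GraphProduct Γ A :=
  SemidirectProduct.lift (kernelHom Γ A S v) (MonoidHom.id _) <| by
    intro g
    refine Monoid.CoprodI.ext_hom _ _ fun i => ?_
    ext x
    obtain ⟨b, rfl⟩ := QuotientGroup.mk_surjective i
    simp only [MonoidHom.comp_apply, MulEquiv.coe_toMonoidHom, Monoid.CoprodI.permAut_of,
      MulAction.Quotient.smul_coe, kernelHom_of, MulAut.conj_apply, MonoidHom.id_apply, smul_eq_mul]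
    group

/-- Being a one-sided inverse on `sub Γ A S` is enough to carry conjugacy statements back from the
splitting. -/
theorem ofSplitting_toSplitting {g : GraphProduct Γ A} (hg : g ∈ sub Γ A S) :
    ofSplitting Γ A S v (toSplitting Γ A S v g) = g := by
  have : sub Γ A S ≤
      ((ofSplitting Γ A S v).comp (toSplitting Γ A S v)).eqLocus (MonoidHom.id _) := by
    refine sub_le fun w hw x => ?_
    change ofSplitting Γ A S v (toSplitting Γ A S v _) = of Γ A w x
    by_cases hwv : w = v
    · subst hwv
      rw [toSplitting_of_self, ofSplitting, SemidirectProduct.lift_inl, kernelHom_of]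
      simp
    · rw [toSplitting_of_ne Γ A S v hw hwv, ofSplitting, SemidirectProduct.lift_inr]
      rfl
  exact this hg

theorem toSplitting_right_mem {g : GraphProduct Γ A} (hg : g ∈ sub Γ A S) :
    (toSplitting Γ A S v g).right ∈ sub Γ A (S \ {v}) := by
  have : sub Γ A S ≤ (sub Γ A (S \ {v})).comap
      (SemidirectProduct.rightHom.comp (toSplitting Γ A S v)) := by
    refine sub_le fun w hw x => ?_
    change (toSplitting Γ A S v (of Γ A w x)).right ∈ sub Γ A (S \ {v})
    by_cases hwv : w = v
    · subst hwv
      rw [toSplitting_of_self, SemidirectProduct.right_inl]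
      exact one_mem _
    · rw [toSplitting_of_ne Γ A S v hw hwv, SemidirectProduct.right_inr]
      exact of_mem_sub (show w ∈ S \ {v} from ⟨hw, hwv⟩) x
  exact this hg

/-- A finite subgroup of the graph product over `S` can be conjugated into the graph product over
`S \ {v}` or over the star of `v` in `S`. -/
theorem exists_conj_of_finite_splitting {F : Subgroup (GraphProduct Γ A)} [Finite F]
    (hv : v ∈ S) (hF : F ≤ sub Γ A S) :
    ∃ g, (∀ f ∈ F, g⁻¹ * f * g ∈ sub Γ A (S \ {v})) ∨
      ∀ f ∈ F, g⁻¹ * f * g ∈ sub Γ A {w ∈ S | w = v ∨ Γ.Adj v w} := by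
  have hfin : Finite (F.map (toSplitting Γ A S v)) :=
    inferInstanceAs (Finite ((toSplitting Γ A S v) '' (F : Set (GraphProduct Γ A)) : Set _))
  rcases Monoid.CoprodI.exists_conj_of_finite (F.map (toSplitting Γ A S v)) with
    ⟨x, h⟩ | ⟨x, i, h⟩
  · refine ⟨kernelHom Γ A S v x, Or.inl fun f hf => ?_⟩
    have h1 := congrArg (ofSplitting Γ A S v) (h _ ⟨f, hf, rfl⟩)
    rw [map_mul, map_mul, map_inv, ofSplitting_toSplitting Γ A S v (hF hf), ofSplitting,
      SemidirectProduct.lift_inl, SemidirectProduct.lift_inr] at h1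
    rw [h1]
    exact toSplitting_right_mem Γ A S v (hF hf)
  · obtain ⟨b, rfl⟩ := QuotientGroup.mk_surjective i
    refine ⟨kernelHom Γ A S v x * b, Or.inr fun f hf => ?_⟩
    obtain ⟨h0, a, ha⟩ := h _ ⟨f, hf, rfl⟩
    have h1 := congrArg (ofSplitting Γ A S v) ha
    rw [map_mul, map_mul, map_inv, map_mul, ofSplitting_toSplitting Γ A S v (hF hf), ofSplitting,
      SemidirectProduct.lift_inl, SemidirectProduct.lift_inl, SemidirectProduct.lift_inr,
      kernelHom_of, MonoidHom.id_apply] at h1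
    set r := (toSplitting Γ A S v f).right
    -- That `r` fixes the coset of `b` means that `b⁻¹ * r * b` lies in the link subgroup.
    rw [MulAction.Quotient.smul_coe, smul_eq_mul, eq_comm, QuotientGroup.eq] at h0
    have h2 : (kernelHom Γ A S v x * b)⁻¹ * f * (kernelHom Γ A S v x * b) =
        of Γ A v a * (b⁻¹ * (r * b)) := by
      calc _ = b⁻¹ * ((kernelHom Γ A S v x)⁻¹ * f * kernelHom Γ A S v x) * b := by group
        _ = _ := by rw [h1]; group
    rw [h2]
    exact mul_mem (of_mem_sub (show v ∈ {w ∈ S | w = v ∨ Γ.Adj v w} from ⟨hv, Or.inl rfl⟩) a)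
      (sub_mono (T := {w ∈ S | w = v ∨ Γ.Adj v w}) (fun w hw => ⟨hw.1, Or.inr hw.2⟩) h0)

end Splitting

/-- A finite subgroup of the graph product over a finite set of vertices can be conjugated into the
subgroup of a clique. -/
theorem exists_conj_clique_of_le_sub {S : Set V} (hS : S.Finite) (F : Subgroup (GraphProduct Γ A))
    [Finite F] (hF : F ≤ sub Γ A S) :
    ∃ K : Set V, Γ.IsClique K ∧ ∃ g, ∀ f ∈ F, g⁻¹ * f * g ∈ sub Γ A K := by
  induction hn : S.ncard using Nat.strong_induction_on generalizing S F with
  | _ n ih =>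
    by_cases hcl : Γ.IsClique S
    · exact ⟨S, hcl, 1, fun f hf => by simpa using hF hf⟩
    rw [SimpleGraph.isClique_iff, Set.Pairwise] at hcl
    push Not at hcl
    -- Both `S \ {v}` and the star of `v` in `S`, which misses `u`, are proper subsets of `S`.
    obtain ⟨v, hv, u, hu, hvu, hadj⟩ := hcl
    have step : ∀ (T : Set V) (g : GraphProduct Γ A), T ⊂ S →
        (∀ f ∈ F, g⁻¹ * f * g ∈ sub Γ A T) →
        ∃ K : Set V, Γ.IsClique K ∧ ∃ g, ∀ f ∈ F, g⁻¹ * f * g ∈ sub Γ A K := by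
      intro T g hT h
      have hfin : Finite (F.map (MulAut.conj g⁻¹).toMonoidHom) :=
        inferInstanceAs (Finite ((MulAut.conj g⁻¹) '' (F : Set (GraphProduct Γ A)) : Set _))
      obtain ⟨K, hK, k, hk⟩ := ih T.ncard (hn ▸ Set.ncard_lt_ncard hT hS) (hS.subset hT.subset)
        (F.map (MulAut.conj g⁻¹).toMonoidHom) (by
          rintro _ ⟨f, hf, rfl⟩
          simpa using h f hf) rfl
      refine ⟨K, hK, g * k, fun f hf => ?_⟩
      have := hk _ ⟨f, hf, rfl⟩
      simpa [mul_assoc] using this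
    obtain ⟨g, h | h⟩ := exists_conj_of_finite_splitting Γ A S v hv hF
    · refine step _ g ⟨Set.sdiff_subset, fun hle => ?_⟩ h
      exact (hle hv).2 rfl
    · refine step _ g ⟨Set.sep_subset _ _, fun hle => ?_⟩ h
      rcases (hle hu).2 with h' | h'
      · exact hvu h'.symm
      · exact hadj h'

theorem exists_conj_clique [Finite V] (F : Subgroup (GraphProduct Γ A)) [Finite F] :
    ∃ K : Set V, Γ.IsClique K ∧ ∃ g, ∀ f ∈ F, g⁻¹ * f * g ∈ sub Γ A K :=
  exists_conj_clique_of_le_sub Set.finite_univ F (sub_univ (Γ := Γ) (A := A) ▸ le_top)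

end GraphProduct

section HomCounting

-- Counting homomorphisms into finite groups

universe u

instance MonoidHom.finite_of_finite {X A : Type*} [Monoid X] [Monoid A] [Finite X] [Finite A] :
    Finite (X →* A) :=
  Finite.of_injective (fun f => (f : X → A)) DFunLike.coe_injective

/-- Homomorphisms with kernel `N` correspond to injective homomorphisms from the quotient by `N`. -/
noncomputable def QuotientGroup.kerEqEquiv {X A : Type*} [Group X] [Group A] (N : Subgroup X)
    [N.Normal] : {f : X →* A // f.ker = N} ≃ {f : X ⧸ N →* A // Function.Injective f} where
  toFun f := ⟨QuotientGroup.lift N f.1 f.2.ge, by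
    rw [injective_iff_map_eq_one]
    intro x hx
    obtain ⟨y, rfl⟩ := QuotientGroup.mk_surjective x
    rw [QuotientGroup.lift_mk] at hx
    rw [QuotientGroup.eq_one_iff, ← f.2]
    exact hx⟩
  invFun f := ⟨f.1.comp (QuotientGroup.mk' N), by
    rw [← MonoidHom.comap_ker, (MonoidHom.ker_eq_bot_iff f.1).mpr f.2, MonoidHom.comap_bot,
      QuotientGroup.ker_mk']⟩
  left_inv f := by
    ext x
    rfl
  right_inv f := by
    ext x
    rfl

/-- Sort homomorphisms by kernel. Those with kernel N ≠ 1 are injective homomorphisms from the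
smaller group X/N, so induction on |X| leaves only the trivial kernel. -/
theorem card_injective_hom_eq {A B : Type u} [Group A] [Group B] [Finite A] [Finite B]
    (h : ∀ (X : Type u) [Group X] [Finite X], Nat.card (X →* A) = Nat.card (X →* B))
    (X : Type u) [Group X] [Finite X] :
    Nat.card {f : X →* A // Function.Injective f} =
      Nat.card {f : X →* B // Function.Injective f} := by
  classical
  induction hn : Nat.card X using Nat.strong_induction_on generalizing X with
  | _ n ih =>
    have := Fintype.ofFinite (Subgroup X)
    have sum : ∀ (D : Type u) [Group D] [Finite D],
        Nat.card (X →* D) = ∑ N : Subgroup X, Nat.card {f : X →* D // f.ker = N} := by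
      intro D _ _
      rw [← Nat.card_sigma]
      exact Nat.card_congr (Equiv.sigmaFiberEquiv fun f : X →* D => f.ker).symm
    have hbot : ∀ (D : Type u) [Group D], Nat.card {f : X →* D // f.ker = ⊥} =
        Nat.card {f : X →* D // Function.Injective f} := fun D _ =>
      Nat.card_congr (Equiv.subtypeEquivRight fun f => MonoidHom.ker_eq_bot_iff f)
    have hrest : ∀ N ∈ Finset.univ.erase (⊥ : Subgroup X),
        Nat.card {f : X →* A // f.ker = N} = Nat.card {f : X →* B // f.ker = N} := by
      intro N hN
      by_cases hnor : N.Normal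
      · rw [Nat.card_congr (QuotientGroup.kerEqEquiv N), Nat.card_congr (QuotientGroup.kerEqEquiv N)]
        refine ih _ ?_ (X ⧸ N) rfl
        have hlt : 1 < Nat.card N := by
          have := (Subgroup.one_lt_card_iff_ne_bot N).mpr (Finset.ne_of_mem_erase hN)
          exact this
        rw [← hn, Subgroup.card_eq_card_quotient_mul_card_subgroup N]
        exact lt_mul_of_one_lt_right Nat.card_pos hlt
      · have hempty : ∀ (D : Type u) [Group D], Nat.card {f : X →* D // f.ker = N} = 0 := by
          intro D _
          have : IsEmpty {f : X →* D // f.ker = N} :=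
            ⟨fun f => hnor (f.2 ▸ MonoidHom.normal_ker f.1)⟩
          exact Nat.card_of_isEmpty
        rw [hempty, hempty]
    have key := h X
    rw [sum, sum, ← Finset.add_sum_erase _ _ (Finset.mem_univ ⊥),
      ← Finset.add_sum_erase _ _ (Finset.mem_univ ⊥), Finset.sum_congr rfl hrest, hbot, hbot] at key
    exact Nat.add_right_cancel key

theorem nonempty_mulEquiv_of_injective {A B : Type*} [Group A] [Group B] [Finite A] [Finite B]
    (f : A →* B) (hf : Function.Injective f) (g : B →* A) (hg : Function.Injective g) :
    Nonempty (A ≃* B) := by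
  have hcard : Nat.card A = Nat.card B :=
    le_antisymm (Nat.card_le_card_of_injective f hf) (Nat.card_le_card_of_injective g hg)
  exact ⟨MulEquiv.ofBijective f ((Nat.bijective_iff_injective_and_card f).mpr ⟨hf, hcard⟩)⟩

/-- Lovász: a finite group is determined by the numbers of homomorphisms into it. -/
theorem nonempty_mulEquiv_of_card_hom_eq {A B : Type u} [Group A] [Group B] [Finite A] [Finite B]
    (h : ∀ (X : Type u) [Group X] [Finite X], Nat.card (X →* A) = Nat.card (X →* B)) :
    Nonempty (A ≃* B) := by
  -- The test group X = A works, since the identity is an injection of A into A.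
  have hAB : Nonempty {f : A →* B // Function.Injective f} := by
    have : Nonempty {f : A →* A // Function.Injective f} :=
      ⟨⟨MonoidHom.id A, Function.injective_id⟩⟩
    exact (Nat.card_pos_iff.mp (card_injective_hom_eq h A ▸ Nat.card_pos)).1
  have hBA : Nonempty {f : B →* A // Function.Injective f} := by
    have : Nonempty {f : B →* B // Function.Injective f} :=
      ⟨⟨MonoidHom.id B, Function.injective_id⟩⟩
    exact (Nat.card_pos_iff.mp ((card_injective_hom_eq h B).symm ▸ Nat.card_pos)).1
  obtain ⟨f, hf⟩ := hAB
  obtain ⟨g, hg⟩ := hBA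
  exact nonempty_mulEquiv_of_injective f hf g hg

theorem card_hom_pi {ι : Type*} [Fintype ι] {A : ι → Type*} [∀ i, Group (A i)] (X : Type*)
    [Group X] : Nat.card (X →* ∀ i, A i) = ∏ i, Nat.card (X →* A i) := by
  rw [← Nat.card_pi]
  exact Nat.card_congr
    { toFun := fun f i => (Pi.evalMonoidHom A i).comp f
      invFun := fun f => MonoidHom.pi f
      left_inv := fun f => rfl
      right_inv := fun f => rfl }

end HomCounting

section Inversion

/-! ### Möbius inversion over labels -/

variable {V V' M : Type*} [Fintype V] [Fintype V']

open scoped Classical in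
theorem prod_filter_subset_eq [Fintype (Set M)] (S : Set M) (d : V → Set M) (k : V → ℕ) :
    ∏ v with S ⊆ d v, k v =
      (∏ v with d v = S, k v) * ∏ T with S ⊂ T, ∏ v with d v = T, k v := by
  have h1 : (Finset.univ.filter fun v => S ⊆ d v) =
      (Finset.univ.filter fun v => d v = S).disjUnion
        (Finset.univ.filter fun v => S ⊂ d v) (by
          rw [Finset.disjoint_filter]
          rintro v - rfl h
          exact ssubset_irrefl _ h) := by
    ext v
    simp only [Finset.mem_filter, Finset.mem_univ, true_and, Finset.mem_disjUnion]
    rw [subset_iff_ssubset_or_eq, or_comm, eq_comm]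
  rw [h1, Finset.prod_disjUnion]
  congr 1
  rw [← Finset.prod_fiberwise_of_maps_to (s := Finset.univ.filter fun v => S ⊂ d v)
    (t := Finset.univ.filter fun T => S ⊂ T) (g := d) (by simp)]
  refine Finset.prod_congr rfl fun T hT => Finset.prod_congr ?_ fun _ _ => rfl
  ext v
  simp only [Finset.mem_filter, Finset.mem_univ, true_and, and_iff_right_iff_imp]
  rintro rfl
  simpa using hT

open scoped Classical in
/-- Multiplicative Möbius inversion over the nonempty subsets of a finite set. -/
theorem prod_fiber_eq_of_prod_superset_eq [Finite M] (c : V → Set M) (c' : V' → Set M) {f : V → ℕ}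
    {f' : V' → ℕ} (hf : ∀ v, 0 < f v)
    (h : ∀ S : Set M, S.Nonempty → ∏ v with S ⊆ c v, f v = ∏ v with S ⊆ c' v, f' v)
    (S : Set M) (hS : S.Nonempty) : ∏ v with c v = S, f v = ∏ v with c' v = S, f' v := by
  have := Fintype.ofFinite (Set M)
  -- Downward induction: the factors of strictly larger labels agree and are positive, so they
  -- cancel.
  induction S using WellFoundedGT.induction with
  | _ S ih =>
    have key := h S hS
    rw [prod_filter_subset_eq, prod_filter_subset_eq, ← Finset.prod_congr rfl fun T hT =>
      ih T (Finset.mem_filter.mp hT).2 (hS.mono (Finset.mem_filter.mp hT).2.subset)] at key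
    exact Nat.eq_of_mul_eq_mul_right
      (Finset.prod_pos fun T _ => Finset.prod_pos fun v _ => hf v) key

universe u

open scoped Classical in
/-- A family of nontrivial finite groups labelled by distinct nonempty subsets of a finite set is
determined by the numbers of homomorphisms into the products over all labels containing a given
nonempty set. -/
theorem exists_label_eq_and_mulEquiv [Finite M] (c : V → Set M) (c' : V' → Set M)
    (hc : Function.Injective c) (hc' : Function.Injective c') (hne : ∀ v, (c v).Nonempty)
    {A : V → Type u} {A' : V' → Type u} [∀ v, Group (A v)] [∀ v, Group (A' v)]
    [∀ v, Finite (A v)] [∀ v, Finite (A' v)] [∀ v, Nontrivial (A v)]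
    (h : ∀ S : Set M, S.Nonempty → ∀ (X : Type u) [Group X] [Finite X],
      ∏ v with S ⊆ c v, Nat.card (X →* A v) = ∏ v with S ⊆ c' v, Nat.card (X →* A' v)) (v : V) :
    ∃ v', c' v' = c v ∧ Nonempty (A v ≃* A' v') := by
  have key : ∀ (X : Type u) [Group X] [Finite X],
      Nat.card (X →* A v) = ∏ w with c' w = c v, Nat.card (X →* A' w) := by
    intro X _ _
    rw [← prod_fiber_eq_of_prod_superset_eq c c' (fun v => Nat.card_pos)
      (fun S hS => h S hS X) (c v) (hne v)]
    simp_rw [hc.eq_iff]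
    rw [Finset.filter_eq' Finset.univ v, if_pos (Finset.mem_univ v), Finset.prod_singleton]
  by_cases hv : ∃ v', c' v' = c v
  · obtain ⟨v', hv'⟩ := hv
    refine ⟨v', hv', nonempty_mulEquiv_of_card_hom_eq fun X _ _ => ?_⟩
    rw [key X, ← hv']
    simp_rw [hc'.eq_iff]
    rw [Finset.filter_eq' Finset.univ v', if_pos (Finset.mem_univ v'), Finset.prod_singleton]
  · exfalso
    -- The product over no labels is 1, but a nontrivial group has two endomorphisms: the identity
    -- and the trivial one.
    have h1 := key (A v)
    rw [Finset.filter_false_of_mem fun w _ hw => hv ⟨w, hw⟩, Finset.prod_empty,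
      Nat.card_eq_one_iff_unique] at h1
    obtain ⟨x, hx⟩ := exists_ne (1 : A v)
    exact hx (DFunLike.congr_fun (h1.1.elim (MonoidHom.id (A v)) 1) x)

end Inversion

section Internal

/-! ### Clique subgroups of an internal graph product -/

variable {G : Type*} [Group G] {V : Type*} {Γ : SimpleGraph V} {H : V → Subgroup G}

/-- The subgroup generated by the vertex groups in a set of vertices. -/
def vertexSub (H : V → Subgroup G) (K : Set V) : Subgroup G := ⨆ v ∈ K, H v

theorem le_vertexSub {K : Set V} {v : V} (hv : v ∈ K) : H v ≤ vertexSub H K :=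
  le_iSup₂ (f := fun v (_ : v ∈ K) => H v) v hv

theorem vertexSub_mono {K L : Set V} (h : K ⊆ L) : vertexSub H K ≤ vertexSub H L :=
  iSup₂_le fun _ hv => le_vertexSub (h hv)

namespace IsInternalGraphProduct

theorem commute (hG : IsInternalGraphProduct Γ H) {u v : V} (h : Γ.Adj u v) {x y : G}
    (hx : x ∈ H u) (hy : y ∈ H v) : Commute x y := by
  obtain ⟨e, he⟩ := hG
  have := (GraphProduct.commute_of_of (A := fun v => H v) h ⟨x, hx⟩ ⟨y, hy⟩).map e
  rwa [he, he] at this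

open scoped Classical in
theorem exists_hom_pi (hG : IsInternalGraphProduct Γ H) :
    ∃ ρ : G →* ∀ v, H v, ∀ v (x : H v), ρ x = Pi.mulSingle v x := by
  obtain ⟨e, he⟩ := hG
  refine ⟨(GraphProduct.lift (fun v => MonoidHom.mulSingle (fun v => H v) v) ?_).comp
    e.symm.toMonoidHom, fun v x => ?_⟩
  · intro u v h x y
    exact Pi.mulSingle_commute (f := fun v => H v) h.ne x y
  · rw [← he v x, MonoidHom.comp_apply, MulEquiv.coe_toMonoidHom, MulEquiv.symm_apply_apply]
    exact GraphProduct.lift_of (A := fun v => H v) _ _ v x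

open scoped Classical in
/-- The homomorphism onto the direct product of the vertex groups. -/
noncomputable def toPi (hG : IsInternalGraphProduct Γ H) : G →* ∀ v, H v :=
  hG.exists_hom_pi.choose

open scoped Classical in
theorem toPi_apply (hG : IsInternalGraphProduct Γ H) {v : V} (x : H v) :
    hG.toPi x = Pi.mulSingle v x :=
  hG.exists_hom_pi.choose_spec v x

theorem toPi_eq_one_of_notMem (hG : IsInternalGraphProduct Γ H) {K : Set V} {x : G}
    (hx : x ∈ vertexSub H K) {v : V} (hv : v ∉ K) : hG.toPi x v = 1 := by
  classical
  have : vertexSub H K ≤ ((Pi.evalMonoidHom (fun v => H v) v).comp hG.toPi).ker := by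
    refine iSup₂_le fun w hw y hy => ?_
    rw [MonoidHom.mem_ker, MonoidHom.comp_apply, Pi.evalMonoidHom_apply,
      hG.toPi_apply (⟨y, hy⟩ : H w), Pi.mulSingle_eq_of_ne]
    rintro rfl
    exact hv hw
  exact this hx

/-- This makes the supports of elements in the direct product insensitive to conjugation. -/
theorem toPi_conj_eq_one_iff (hG : IsInternalGraphProduct Γ H) (g x : G) (v : V) :
    hG.toPi (g⁻¹ * x * g) v = 1 ↔ hG.toPi x v = 1 := by
  simp only [map_mul, map_inv, Pi.mul_apply, Pi.inv_apply]
  rw [mul_assoc, inv_mul_eq_one, eq_comm, mul_eq_right]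

/-- A clique subgroup that can be conjugated into another one comes from a smaller clique. -/
theorem subset_of_conj (hG : IsInternalGraphProduct Γ H) (hnt : ∀ v, Nontrivial (H v))
    {K L : Set V} {g : G} (h : ∀ x ∈ vertexSub H K, g⁻¹ * x * g ∈ vertexSub H L) : K ⊆ L := by
  classical
  intro v hv
  by_contra hvL
  obtain ⟨x, hx⟩ := exists_ne (1 : H v)
  have h1 := hG.toPi_eq_one_of_notMem (h x (le_vertexSub hv x.2)) hvL
  rw [toPi_conj_eq_one_iff, toPi_apply, Pi.mulSingle_eq_same] at h1
  exact hx h1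

variable [Finite V]

theorem exists_conj_clique (hG : IsInternalGraphProduct Γ H) (F : Subgroup G) [Finite F] :
    ∃ K : Set V, Γ.IsClique K ∧ ∃ g, ∀ f ∈ F, g⁻¹ * f * g ∈ vertexSub H K := by
  obtain ⟨e, he⟩ := hG
  have hfin : Finite (F.map e.symm.toMonoidHom) :=
    inferInstanceAs (Finite (e.symm '' (F : Set G) : Set _))
  obtain ⟨K, hK, g, hg⟩ := GraphProduct.exists_conj_clique (F.map e.symm.toMonoidHom)
  refine ⟨K, hK, e g, fun f hf => ?_⟩
  have hle : GraphProduct.sub Γ (fun v => H v) K ≤ (vertexSub H K).comap e.toMonoidHom := by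
    refine GraphProduct.sub_le fun v hv x => ?_
    change e (GraphProduct.of Γ (fun v => H v) v x) ∈ vertexSub H K
    rw [he]
    exact le_vertexSub hv x.2
  have h1 : e (g⁻¹ * e.symm f * g) ∈ vertexSub H K := hle (hg _ ⟨f, hf, rfl⟩)
  simpa using h1

/-- The subgroup of a clique is the direct product of its vertex groups. -/
theorem exists_pi_equiv (hG : IsInternalGraphProduct Γ H) {K : Set V} (hK : Γ.IsClique K) :
    ∃ s : (∀ v : K, H v) ≃* vertexSub H K, ∀ p (v : K), hG.toPi (s p) v = p v := by
  classical
  have := Fintype.ofFinite V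
  have hcomm : Pairwise fun u v : K => ∀ x y : G, x ∈ H u → y ∈ H v → Commute x y :=
    fun u v huv x y hx hy => hG.commute (hK u.2 v.2 (Subtype.coe_ne_coe.mpr huv)) hx hy
  let s := Subgroup.noncommPiCoprod (H := fun v : K => H v) hcomm
  have hrange : s.range = vertexSub H K := by
    rw [Subgroup.noncommPiCoprod_range, vertexSub, iSup_subtype']
  let r : G →* ∀ v : K, H v := MonoidHom.pi fun v => (Pi.evalMonoidHom (fun v => H v) v).comp hG.toPi
  have hr : ∀ x v, r x v = hG.toPi x v := fun _ _ => rfl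
  have hrs : r.comp s = MonoidHom.id _ := by
    ext p : 1
    refine Subgroup.pi_mem_of_mulSingle_mem (H := (r.comp s).eqLocus (MonoidHom.id _)) p
      fun v => ?_
    generalize p v = x
    change r (s (Pi.mulSingle v x)) = Pi.mulSingle v x
    funext w
    have h1 : s (Pi.mulSingle v x) = x := 
      Subgroup.noncommPiCoprod_mulSingle (H := fun v : K => H v) (hcomm := hcomm) v x
    rw [h1, hr, hG.toPi_apply]
    by_cases hvw : w = v
    · subst hvw; simp
    · rw [Pi.mulSingle_eq_of_ne hvw, Pi.mulSingle_eq_of_ne (Subtype.coe_ne_coe.mpr hvw)]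
  have hinj : Function.Injective s := fun p q hpq => by
    have h1 := DFunLike.congr_fun hrs p
    have h2 := DFunLike.congr_fun hrs q
    simp only [MonoidHom.comp_apply, MonoidHom.id_apply] at h1 h2
    rw [← h1, ← h2, hpq]
  refine ⟨(MonoidHom.ofInjective hinj).trans (MulEquiv.subgroupCongr hrange), fun p v => ?_⟩
  exact congrFun (DFunLike.congr_fun hrs p) v

theorem eq_one_of_toPi_eq_one (hG : IsInternalGraphProduct Γ H) {K : Set V} (hK : Γ.IsClique K)
    {x : G} (hx : x ∈ vertexSub H K) (h : ∀ v, hG.toPi x v = 1) : x = 1 := by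
  obtain ⟨s, hs⟩ := hG.exists_pi_equiv hK
  obtain ⟨p, hp⟩ := s.surjective ⟨x, hx⟩
  have hp1 : p = 1 := by
    funext v
    rw [← hs p v, hp]
    exact h v
  rw [hp1, map_one] at hp
  exact (congrArg Subtype.val hp).symm

theorem finite_vertexSub (hG : IsInternalGraphProduct Γ H) (hfin : ∀ v, Finite (H v)) {K : Set V}
    (hK : Γ.IsClique K) : Finite (vertexSub H K) :=
  let ⟨s, _⟩ := hG.exists_pi_equiv hK
  Finite.of_equiv _ s.toEquiv

open scoped Classical in
theorem card_hom_vertexSub [Fintype V] (hG : IsInternalGraphProduct Γ H) {K : Set V}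
    (hK : Γ.IsClique K) (X : Type*) [Group X] :
    Nat.card (X →* vertexSub H K) = ∏ v with v ∈ K, Nat.card (X →* H v) := by
  obtain ⟨s, -⟩ := hG.exists_pi_equiv hK
  rw [← Nat.card_congr (MulEquiv.monoidHomCongrRightEquiv s), card_hom_pi]
  exact (Finset.prod_subtype _ (by simp) fun v => Nat.card (X →* H v)).symm

/-- A subgroup that can be conjugated into each of several clique subgroups embeds into the subgroup
of the intersection of the cliques. -/
theorem exists_injective_hom_of_conj (hG : IsInternalGraphProduct Γ H) {ι : Type*} [Nonempty ι]
    {K : ι → Set V} (hK : ∀ i, Γ.IsClique (K i)) {L : Set V} (hL : ∀ v, (∀ i, v ∈ K i) → v ∈ L)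
    (hLc : Γ.IsClique L) {Q : Subgroup G}
    (h : ∀ i, ∃ g, ∀ x ∈ Q, g⁻¹ * x * g ∈ vertexSub H (K i)) :
    ∃ f : Q →* vertexSub H L, Function.Injective f := by
  obtain ⟨s, -⟩ := hG.exists_pi_equiv hLc
  let r : Q →* ∀ v : L, H v :=
    MonoidHom.pi fun v => ((Pi.evalMonoidHom (fun v => H v) v).comp hG.toPi).comp Q.subtype
  refine ⟨s.toMonoidHom.comp r, s.injective.comp ?_⟩
  rw [injective_iff_map_eq_one]
  rintro ⟨x, hx⟩ hrx
  -- A coordinate outside `L` is missed by some `K i`, and the conjugator for that `i` does not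
  -- affect its vanishing. No simultaneous conjugation is needed.
  have hx1 : ∀ v, hG.toPi x v = 1 := by
    intro v
    by_cases hv : v ∈ L
    · exact congrFun hrx ⟨v, hv⟩
    · obtain ⟨i, hi⟩ : ∃ i, v ∉ K i := by
        by_contra! hc
        exact hv (hL v hc)
      obtain ⟨g, hg⟩ := h i
      exact (hG.toPi_conj_eq_one_iff g x v).mp (hG.toPi_eq_one_of_notMem (hg x hx) hi)
  obtain ⟨i⟩ := ‹Nonempty ι›
  obtain ⟨g, hg⟩ := h i
  have h1 := hG.eq_one_of_toPi_eq_one (hK i) (hg x hx)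
    fun v => (hG.toPi_conj_eq_one_iff g x v).mpr (hx1 v)
  have h2 : x = 1 := by
    have : x = g * (g⁻¹ * x * g) * g⁻¹ := by group
    rw [this, h1]; group
  exact Subtype.ext h2

end IsInternalGraphProduct

end Internal

namespace SimpleGraph

/-! ### Maximal cliques -/

variable {V : Type*} {Γ : SimpleGraph V} [Finite V]

variable (Γ) in
/-- The maximal cliques of a graph. -/
abbrev MaxClique : Type _ := {C : Set V // Maximal Γ.IsClique C}

theorem exists_maxClique_superset {K : Set V} (hK : Γ.IsClique K) :
    ∃ C : Γ.MaxClique, K ⊆ C.1 := by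
  obtain ⟨C, h1, h2⟩ := (Set.toFinite {C : Set V | Γ.IsClique C}).exists_le_maximal hK
  exact ⟨⟨C, h2⟩, h1⟩

theorem exists_maxClique_mem (v : V) : ∃ C : Γ.MaxClique, v ∈ C.1 := by
  obtain ⟨C, hC⟩ := exists_maxClique_superset (Γ := Γ) (K := {v})
    (Set.pairwise_singleton _ _)
  exact ⟨C, hC rfl⟩

theorem adj_iff_exists_maxClique {u v : V} :
    Γ.Adj u v ↔ u ≠ v ∧ ∃ C : Γ.MaxClique, u ∈ C.1 ∧ v ∈ C.1 := by
  refine ⟨fun h => ⟨h.ne, ?_⟩, fun ⟨hne, C, hu, hv⟩ => C.2.1 hu hv hne⟩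
  obtain ⟨C, hC⟩ := exists_maxClique_superset (Γ := Γ) (K := {u, v})
    (isClique_pair.mpr fun _ => h)
  exact ⟨C, hC (by simp), hC (by simp)⟩

/-- Distinct vertices in the same maximal cliques would be adjacent with the same other neighbours,
hence an edge that is a module. -/
theorem IsT0.eq_of_mem_maxClique_iff (h : Γ.IsT0) {u v : V}
    (huv : ∀ C : Γ.MaxClique, u ∈ C.1 ↔ v ∈ C.1) : u = v := by
  by_contra hne
  obtain ⟨C, hC⟩ := exists_maxClique_mem (Γ := Γ) u
  refine h u v (adj_iff_exists_maxClique.mpr ⟨hne, C, hC, (huv C).mp hC⟩) fun w hw => ?_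
  simp only [Set.mem_insert_iff, Set.mem_singleton_iff, not_or] at hw
  have key : Γ.Adj w u ↔ Γ.Adj w v := by
    rw [adj_iff_exists_maxClique, adj_iff_exists_maxClique]
    simp [hw.1, hw.2, huv]
  by_cases hwu : Γ.Adj w u
  · left
    simp [hwu, key.mp hwu]
  · right
    simp [hwu, mt key.mpr hwu]

end SimpleGraph

section Rigidity

-- Comparing two decompositions of one group

universe u

variable {G : Type u} [Group G] {V V' : Type*}
  {Γ : SimpleGraph V} {Γ' : SimpleGraph V'} {H : V → Subgroup G} {H' : V' → Subgroup G}

/-- Composing the two conjugations puts the group of C into that of τ(σ(C)) up to conjugacy, so C ⊆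
τ(σ(C)), and C is maximal. -/
theorem leftInverse_maxClique_map (hnt : ∀ v, Nontrivial (H v)) (hG : IsInternalGraphProduct Γ H)
    {σ : Γ.MaxClique → Γ'.MaxClique} {τ : Γ'.MaxClique → Γ.MaxClique}
    (hσ : ∀ C, ∃ g, ∀ x ∈ vertexSub H C.1, g⁻¹ * x * g ∈ vertexSub H' (σ C).1)
    (hτ : ∀ C, ∃ g, ∀ x ∈ vertexSub H' C.1, g⁻¹ * x * g ∈ vertexSub H (τ C).1) :
    Function.LeftInverse τ σ := by
  intro C
  obtain ⟨g, hg⟩ := hσ C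
  obtain ⟨k, hk⟩ := hτ (σ C)
  have hsub : C.1 ⊆ (τ (σ C)).1 := hG.subset_of_conj hnt (g := g * k) fun x hx => by
    have := hk _ (hg x hx)
    simpa [mul_assoc] using this
  exact Subtype.ext (C.2.eq_of_subset (τ (σ C)).2.1 hsub).symm

variable [Finite V] [Finite V']

theorem exists_maxClique_map (hfin : ∀ v, Finite (H v)) (hG : IsInternalGraphProduct Γ H)
    (hG' : IsInternalGraphProduct Γ' H') :
    ∃ σ : Γ.MaxClique → Γ'.MaxClique, ∀ C, ∃ g, ∀ x ∈ vertexSub H C.1,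
      g⁻¹ * x * g ∈ vertexSub H' (σ C).1 := by
  have : ∀ C : Γ.MaxClique, ∃ C' : Γ'.MaxClique, ∃ g, ∀ x ∈ vertexSub H C.1,
      g⁻¹ * x * g ∈ vertexSub H' C'.1 := by
    intro C
    have := hG.finite_vertexSub hfin C.2.1
    obtain ⟨K, hK, g, hg⟩ := hG'.exists_conj_clique (vertexSub H C.1)
    obtain ⟨C', hC'⟩ := SimpleGraph.exists_maxClique_superset hK
    exact ⟨C', g, fun x hx => vertexSub_mono hC' (hg x hx)⟩
  exact ⟨fun C => (this C).choose, fun C => (this C).choose_spec⟩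

open scoped Classical in
-- The two intersection subgroups embed in each other; being finite, they are isomorphic.
theorem card_hom_inter_eq [Fintype V] [Fintype V'] (hfin : ∀ v, Finite (H v))
    (hfin' : ∀ v, Finite (H' v)) (hG : IsInternalGraphProduct Γ H)
    (hG' : IsInternalGraphProduct Γ' H') {ι : Type*} [Nonempty ι] {K : ι → Set V}
    {K' : ι → Set V'} (hK : ∀ i, Γ.IsClique (K i)) (hK' : ∀ i, Γ'.IsClique (K' i))
    (h : ∀ i, ∃ g, ∀ x ∈ vertexSub H (K i), g⁻¹ * x * g ∈ vertexSub H' (K' i))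
    (h' : ∀ i, ∃ g, ∀ x ∈ vertexSub H' (K' i), g⁻¹ * x * g ∈ vertexSub H (K i))
    (X : Type*) [Group X] :
    ∏ v with ∀ i, v ∈ K i, Nat.card (X →* H v) =
      ∏ v with ∀ i, v ∈ K' i, Nat.card (X →* H' v) := by
  obtain ⟨i₀⟩ := id ‹Nonempty ι›
  have hL : Γ.IsClique {v | ∀ i, v ∈ K i} := (hK i₀).subset fun v hv => hv i₀
  have hL' : Γ'.IsClique {v | ∀ i, v ∈ K' i} := (hK' i₀).subset fun v hv => hv i₀
  have := hG.finite_vertexSub hfin hL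
  have := hG'.finite_vertexSub hfin' hL'
  obtain ⟨f, hf⟩ := hG'.exists_injective_hom_of_conj hK' (L := {v | ∀ i, v ∈ K' i})
    (fun v hv => hv) hL'
    (Q := vertexSub H {v | ∀ i, v ∈ K i}) fun i => by
      obtain ⟨g, hg⟩ := h i
      exact ⟨g, fun x hx => hg x (vertexSub_mono (K := {v | ∀ i, v ∈ K i}) (fun v hv => hv i) hx)⟩
  obtain ⟨k, hk⟩ := hG.exists_injective_hom_of_conj hK (L := {v | ∀ i, v ∈ K i})
    (fun v hv => hv) hL
    (Q := vertexSub H' {v | ∀ i, v ∈ K' i}) fun i => by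
      obtain ⟨g, hg⟩ := h' i
      exact ⟨g, fun x hx => hg x (vertexSub_mono (K := {v | ∀ i, v ∈ K' i}) (fun v hv => hv i) hx)⟩
  obtain ⟨e⟩ := nonempty_mulEquiv_of_injective f hf k hk
  have h1 := hG.card_hom_vertexSub hL X
  have h2 := hG'.card_hom_vertexSub hL' X
  rw [Nat.card_congr (MulEquiv.monoidHomCongrRightEquiv e), h2] at h1
  exact h1.symm

end Rigidity

theorem mainTheorem2 {G : Type*} [Group G] {V V' : Type*} [Finite V] [Finite V']
    (Γ : SimpleGraph V) (Γ' : SimpleGraph V')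
    (H : V → Subgroup G) (H' : V' → Subgroup G)
    (hfin : ∀ v, Finite (H v)) (hfin' : ∀ v', Finite (H' v'))
    (hnt : ∀ v, Nontrivial (H v)) (hnt' : ∀ v', Nontrivial (H' v'))
    (hG : IsInternalGraphProduct Γ H) (hG' : IsInternalGraphProduct Γ' H')
    (hT0 : Γ.IsT0) (hT0' : Γ'.IsT0) :
    IsomorphicGraphsOfGroups Γ (fun v => H v) Γ' (fun v' => H' v') := by
  classical
  have := Fintype.ofFinite V
  have := Fintype.ofFinite V'
  obtain ⟨σ, hσ⟩ := exists_maxClique_map hfin hG hG'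
  obtain ⟨τ, hτ⟩ := exists_maxClique_map hfin' hG' hG
  have hτσ := leftInverse_maxClique_map hnt hG hσ hτ
  have hστ := leftInverse_maxClique_map hnt' hG' hτ hσ
  -- Both vertex sets are labelled by sets of maximal cliques of `Γ`, those of `Γ'` being
  -- transported along `σ`.
  let c : V → Set Γ.MaxClique := fun v => {C | v ∈ C.1}
  let c' : V' → Set Γ.MaxClique := fun v => {C | v ∈ (σ C).1}
  have hc : Function.Injective c := fun u v huv =>
    hT0.eq_of_mem_maxClique_iff fun C => Set.ext_iff.mp huv C
  have hc' : Function.Injective c' := fun u v huv =>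
    hT0'.eq_of_mem_maxClique_iff fun C => by
      have : u ∈ (σ (τ C)).1 ↔ v ∈ (σ (τ C)).1 := Set.ext_iff.mp huv (τ C)
      rwa [hστ C] at this
  have hne : ∀ v, (c v).Nonempty := fun v => SimpleGraph.exists_maxClique_mem v
  have hne' : ∀ v, (c' v).Nonempty := fun v => by
    obtain ⟨C, hC⟩ := SimpleGraph.exists_maxClique_mem (Γ := Γ') v
    refine ⟨τ C, ?_⟩
    change v ∈ (σ (τ C)).1
    rwa [hστ C]
  have hcount : ∀ S : Set Γ.MaxClique, S.Nonempty → ∀ (X : Type _) [Group X] [Finite X],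
      ∏ v with S ⊆ c v, Nat.card (X →* H v) = ∏ v with S ⊆ c' v, Nat.card (X →* H' v) := by
    intro S hS X _ _
    -- Nonemptiness of `S` matters: only then is the intersection of its members a clique.
    have := hS.to_subtype
    have key := card_hom_inter_eq hfin hfin' hG hG' (K := fun C : S => C.1.1)
      (K' := fun C : S => (σ C.1).1) (fun C => C.1.2.1) (fun C => (σ C.1).2.1)
      (fun C => hσ C.1) (fun C => by
        have := hτ (σ C.1)
        rwa [hτσ C.1] at this) X
    simpa [Set.subset_def, c, c'] using key
  choose φ hφ hφe using fun v => exists_label_eq_and_mulEquiv c c' hc hc' hne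
    (A := fun v => H v) (A' := fun v => H' v) hcount v
  choose ψ hψ _ using fun v => exists_label_eq_and_mulEquiv c' c hc' hc hne'
    (A := fun v => H' v) (A' := fun v => H v) (fun S hS X _ _ => (hcount S hS X).symm) v
  refine ⟨⟨⟨φ, ψ, fun v => hc (by rw [hψ, hφ]), fun v => hc' (by rw [hφ, hψ])⟩, ?_⟩, hφe⟩
  intro u v
  have hmem : ∀ v C, φ v ∈ (σ C).1 ↔ v ∈ C.1 := fun v C => Set.ext_iff.mp (hφ v) C
  have hinj : ∀ u v, φ u = φ v ↔ u = v := fun u v =>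
    ⟨fun h => hc (by rw [← hφ, ← hφ, h]), fun h => h ▸ rfl⟩
  change Γ'.Adj (φ u) (φ v) ↔ Γ.Adj u v
  -- Every maximal clique of `Γ'` has the form `σ C`, and `φ` preserves labels.
  rw [SimpleGraph.adj_iff_exists_maxClique, SimpleGraph.adj_iff_exists_maxClique, ne_eq, ne_eq,
    hinj, (Function.LeftInverse.surjective hστ).exists]
  simp only [hmem]
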